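/- Let $\mathbb T\subseteq\mathbb R$ be a time scale (nonempty closed set), $a,b\in\mathbb T$, $a\le b$, and regard $I=[a,b]=\{t\in\mathbb T: a\le t\le b\}$ as a time scale with forward and backward jump operators $\sigma,\rho$ (so $\rho(a)=a$, $\sigma(b)=b$). A point $t$ is left-dense if $\rho(t)=t$ and right-dense if $\sigma(t)=t$; $I_\kappa=I\setminus\{a\}$ if $\sigma(a)>a$ and $I_\kappa=I$ otherwise. The nabla derivative $g^\nabla(t)$, $t\in I_\kappa$, is the number such that for every $\varepsilon>0$ one has $|g(\rho(t))-g(s)-g^\nabla(t)(\rho(t)-s)|\le\varepsilon|\rho(t)-s|$ for all $s\in I$ near $t$. A function is ld-continuous if it is continuous at left-dense points and has finite right-sided limits at right-dense points; $C^1_{ld}$ is the set of $x:I\to\mathbb R$ that are nabla differentiable on $I_\kappa$ with ld-continuous $x^\nabla$. The nabla integral is $\int_c^d g\,\nabla t=G(d)-G(c)$, where $G^\nabla=g$ on $I_\kappa$. Write $x^\rho=x\circ\rho$ and $$\|x\|_1=\sup_{t\in I}|x^\rho(t)|+\sup_{t\in I_\kappa}|x^\nabla(t)|.$$ Let $f_1,f_2:I\times\mathbb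 R^2\to\mathbb R$, $(t,y,v)\mapsto f_i(t,y,v)$, be such that for each $t$ the partial derivatives $f_{iy},f_{iv}$ exist and are continuous in $(y,v)$; that $f_{iy},f_{iv}$ are bounded on bounded subsets of $I\times\mathbb R^2$; and that for every $x\in C^1_{ld}$ the functions $f_i,f_{iy},f_{iv}$ evaluated at $(t,x^\rho(t),x^\nabla(t))$ are ld-continuous in $t$. Put $\mathcal F_i[x]=\int_a^b f_i(t,x^\rho(t),x^\nabla(t))\nabla t$. Let $\tilde x$ be a weak local minimizer or maximizer of $\mathcal L[x]=\mathcal F_1[x]\,\mathcal F_2[x]$ over the admissible functions, i.e. those $x\in C^1_{ld}$ satisfying the end-point conditions $x(a)=x_a$, $x(b)=x_b$, each of which may or may not be imposed (that is, $\mathcal L[\tilde x]\le\mathcal L[x]$, respectively $\ge$, for all admissible $x$ with $\|x-\tilde x\|_1<\delta$, for some $\delta>0$). Abbreviate $f_{iy}(t)=f_{iy}(t,\tilde x^\rho(t),\tilde x^\nabla(t))$ and $f_{iv}(t)=f_{iv}(t,\tilde x^\rho(t),\tilde x^\nabla(t))$. Then: 1. (Euler–Lagrange equation.) For every $t\in[a,b]_\kappa$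 with $\rho(t)\in[a,b]_\kappa$, the function $\mathcal F_2[\tilde x]f_{1v}+\mathcal F_1[\tilde x]f_{2v}$ is nabla differentiable at $t$ with $$\bigl(\mathcal F_2[\tilde x]f_{1v}+\mathcal F_1[\tilde x]f_{2v}\bigr)^\nabla(t)=\mathcal F_2[\tilde x]f_{1y}(t)+\mathcal F_1[\tilde x]f_{2y}(t);$$ in particular, whenever $f_{1v}^\nabla(t)$ and $f_{2v}^\nabla(t)$ both exist, $$\mathcal F_2[\tilde x]\bigl(f_{1v}^\nabla(t)-f_{1y}(t)\bigr)+\mathcal F_1[\tilde x]\bigl(f_{2v}^\nabla(t)-f_{2y}(t)\bigr)=0 .$$ If $a$ is right-scattered (so that $\tilde x^\nabla(a)$, and hence $f_{iv}(a)$, is undefined), the first of these equations holds for all $t\in[a,b]_\kappa$ once $\mathcal F_2[\tilde x]f_{1v}+\mathcal F_1[\tilde x]f_{2v}$ is given a suitable value at $a$. 2. If $x(a)$ is not specified, then $$\mathcal F_2[\tilde x]\Bigl(\int_a^{\sigma(a)}f_{1y}(t)\nabla t-f_{1v}(\sigma(a))\Bigr)+\mathcal F_1[\tilde x]\Bigl(\int_a^{\sigma(a)}f_{2y}(t)\nabla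 t-f_{2v}(\sigma(a))\Bigr)=0 .$$ 3. If $x(b)$ is not specified, then $\mathcal F_2[\tilde x]f_{1v}(b)+\mathcal F_1[\tilde x]f_{2v}(b)=0$. -/

import Mathlib

open Filter Topology

noncomputable section

namespace TimeScale

/-! The time scale calculus on a closed set `S` of reals. Functions on `S` are written as functions
on `ℝ`; every notion below only looks at their values on `S`. -/

/-- Forward jump operator of the time scale `S`; the maximum of `S` (if any) is sent to itself. -/
def sigma (S : Set ℝ) (t : ℝ) : ℝ :=
  open Classical in if (S ∩ Set.Ioi t).Nonempty then sInf (S ∩ Set.Ioi t) else t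

/-- Backward jump operator of the time scale `S`; the minimum of `S` (if any) is sent to itself. -/
def rho (S : Set ℝ) (t : ℝ) : ℝ :=
  open Classical in if (S ∩ Set.Iio t).Nonempty then sSup (S ∩ Set.Iio t) else t

/-- The set `S_κ`: the time scale `S` without its minimum if that minimum is right-scattered, and
`S` itself otherwise. -/
def lowerKappa (S : Set ℝ) : Set ℝ :=
  {t | t ∈ S ∧ ¬ (IsLeast S t ∧ t < sigma S t)}

/-- `d` is a nabla derivative of `g` at `t` on the time scale `S`. -/
def HasNablaDerivAt (S : Set ℝ) (g : ℝ → ℝ) (d t : ℝ) : Prop :=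
  ∀ ε : ℝ, 0 < ε → ∃ U ∈ 𝓝 t, ∀ s ∈ U ∩ S,
    |g (rho S t) - g s - d * (rho S t - s)| ≤ ε * |rho S t - s|

/-- The nabla derivative `g^∇(t)` on `S` (it is `0` if there is none). -/
def nablaDeriv (S : Set ℝ) (g : ℝ → ℝ) (t : ℝ) : ℝ :=
  open Classical in if h : ∃ d, HasNablaDerivAt S g d t then h.choose else 0

/-- `g` is ld-continuous on `S`: continuous at the left-dense points (those with `ρ(t) = t`), with
finite right-sided limits at the right-dense points. -/
def LdContinuous (S : Set ℝ) (g : ℝ → ℝ) : Prop :=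
  (∀ t ∈ S, rho S t = t → ContinuousWithinAt g S t) ∧
  (∀ t ∈ S, sigma S t = t → ∃ l : ℝ, Tendsto g (𝓝[S ∩ Set.Ioi t] t) (𝓝 l))

/-- The class `C¹_ld(S)`. If `S` has a right-scattered minimum, the derivative is not defined
there; as that point is isolated, the value taken there by `nablaDeriv` has no influence on
ld-continuity. -/
def C1ld (S : Set ℝ) (x : ℝ → ℝ) : Prop :=
  (∀ t ∈ lowerKappa S, ∃ d, HasNablaDerivAt S x d t) ∧ LdContinuous S (nablaDeriv S x)

/-- `G` is a nabla antiderivative of `g` on `S`. -/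
def IsNablaAntideriv (S : Set ℝ) (g G : ℝ → ℝ) : Prop :=
  ∀ t ∈ lowerKappa S, HasNablaDerivAt S G (g t) t

/-- The nabla integral `∫_c^d g(t) ∇t` on `S`, that is, `G(d) - G(c)` for a nabla antiderivative `G`
of `g` (and `0` if there is none; every ld-continuous function has one). -/
def nablaIntegral (S : Set ℝ) (g : ℝ → ℝ) (c d : ℝ) : ℝ :=
  open Classical in
    if h : ∃ G, IsNablaAntideriv S g G then h.choose d - h.choose c else 0

/-- The partial derivative `f_y(t, y, v)`. -/
def partialY (f : ℝ → ℝ → ℝ → ℝ) (t y v : ℝ) : ℝ := deriv (fun z => f t z v) y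

/-- The partial derivative `f_v(t, y, v)`. -/
def partialV (f : ℝ → ℝ → ℝ → ℝ) (t y v : ℝ) : ℝ := deriv (fun w => f t y w) v

/-- The function `t ↦ f(t, x^ρ(t), x^∇(t))`. -/
def along (S : Set ℝ) (f : ℝ → ℝ → ℝ → ℝ) (x : ℝ → ℝ) (t : ℝ) : ℝ :=
  f t (x (rho S t)) (nablaDeriv S x t)

/-- The standing assumptions on a Lagrangian `f` on the time scale `S`. -/
structure IsLagrangian (S : Set ℝ) (f : ℝ → ℝ → ℝ → ℝ) : Prop where
  differentiable_y : ∀ t ∈ S, ∀ y v, DifferentiableAt ℝ (fun z => f t z v) y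
  differentiable_v : ∀ t ∈ S, ∀ y v, DifferentiableAt ℝ (fun w => f t y w) v
  continuous_partialY : ∀ t ∈ S, Continuous fun p : ℝ × ℝ => partialY f t p.1 p.2
  continuous_partialV : ∀ t ∈ S, Continuous fun p : ℝ × ℝ => partialV f t p.1 p.2
  ldContinuous : ∀ x, C1ld S x → LdContinuous S (along S f x)
  ldContinuous_partialY : ∀ x, C1ld S x → LdContinuous S (along S (partialY f) x)
  ldContinuous_partialV : ∀ x, C1ld S x → LdContinuous S (along S (partialV f) x)
  /-- The partial derivatives are bounded on bounded sets of `S × ℝ × ℝ`. -/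
  locallyBounded : ∀ R : ℝ, ∃ M : ℝ, ∀ t ∈ S, |t| ≤ R → ∀ y v, |y| ≤ R → |v| ≤ R →
    |partialY f t y v| ≤ M ∧ |partialV f t y v| ≤ M

/-- The interval `[a, b]` of the time scale `T`. It is itself a time scale, and the variational
problem lives on it. -/
def interval (T : Set ℝ) (a b : ℝ) : Set ℝ := T ∩ Set.Icc a b

/-- The functional `x ↦ ∫_a^b f(t, x^ρ(t), x^∇(t)) ∇t` on `[a, b] ⊆ T`. -/
def functional (T : Set ℝ) (a b : ℝ) (f : ℝ → ℝ → ℝ → ℝ) (x : ℝ → ℝ) : ℝ :=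
  nablaIntegral (interval T a b) (along (interval T a b) f x) a b

/-- The norm `sup |x^ρ| + sup |x^∇|` of `C¹_ld` on `S`. -/
def norm1 (S : Set ℝ) (x : ℝ → ℝ) : ℝ :=
  sSup ((fun t => |x (rho S t)|) '' S) + sSup ((fun t => |nablaDeriv S x t|) '' lowerKappa S)

/-- Admissible functions. An end-point condition is given by `some` value; it is absent (the end
point is free) if it is `none`. -/
def Admissible (T : Set ℝ) (a b : ℝ) (xa xb : Option ℝ) (x : ℝ → ℝ) : Prop :=
  C1ld (interval T a b) x ∧ (∀ c, xa = some c → x a = c) ∧ (∀ c, xb = some c → x b = c)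

/-- `x₀` is a weak local minimizer of `L` among the admissible functions. -/
def IsWeakLocalMin (T : Set ℝ) (a b : ℝ) (xa xb : Option ℝ) (L : (ℝ → ℝ) → ℝ)
    (x₀ : ℝ → ℝ) : Prop :=
  Admissible T a b xa xb x₀ ∧ ∃ δ : ℝ, 0 < δ ∧ ∀ x, Admissible T a b xa xb x →
    norm1 (interval T a b) (fun t => x t - x₀ t) < δ → L x₀ ≤ L x

/-- `x₀` is a weak local maximizer of `L` among the admissible functions. -/
def IsWeakLocalMax (T : Set ℝ) (a b : ℝ) (xa xb : Option ℝ) (L : (ℝ → ℝ) → ℝ)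
    (x₀ : ℝ → ℝ) : Prop :=
  Admissible T a b xa xb x₀ ∧ ∃ δ : ℝ, 0 < δ ∧ ∀ x, Admissible T a b xa xb x →
    norm1 (interval T a b) (fun t => x t - x₀ t) < δ → L x ≤ L x₀

end TimeScale

end

open TimeScale

/-!
The proof is the classical one, by the first variation and the du Bois-Reymond lemma, with the nabla
integral turned into a Lebesgue integral.

Put `S = [a, b]` and `P = F₂ f₁y + F₁ f₂y`, `Q = F₂ f₁v + F₁ f₂v` along the extremizer. An
ld-continuous function `g` is bounded on `S` and continuous off countably many points, so that
`t ↦ ∫ s in a..t, g (nextPoint S s)` makes sense, where `nextPoint S s` is the first point of `S`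
that is not before `s`. This is a nabla antiderivative of `g`
(`IsTimeInterval.isNablaAntideriv_integral`), and since a function with vanishing nabla derivative
is constant (`IsTimeInterval.eq_of_hasNablaDerivAt_zero`), it computes the nabla integral of `g`.

Dominated convergence now gives the first variation of each factor
(`IsTimeInterval.hasDerivAt_nablaIntegral_along`), and stationarity of the product means
`∫ (P η^ρ + Q η^∇) ∇t = 0` for every admissible variation `η`
(`nablaIntegral_variation_eq_zero`). With `A` the indefinite integral of `P`, integration by parts
turns this into `∫ (Q - A) η^∇ ∇t = -A(b) η(b)`. Choosing `η` with `η^∇ = Q - A - c`, where `c` is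
the mean of `Q - A`, shows that `Q = A + c` on `S_κ`; if an end point is free, an affine `η` gives
`c = 0` or `A(b) + c = 0` (`IsTimeInterval.exists_eq_add_const`). The Euler–Lagrange equation is the
nabla derivative of `Q = A + c`, and the natural boundary conditions are its values at `σ(a)` and
`b`. On a single point, `a = b`, every integral vanishes and all claims are trivial.
-/

namespace TimeScale

open MeasureTheory Set
open scoped Interval

variable {S : Set ℝ} {a b s t r d e : ℝ} {g k : ℝ → ℝ}

/-! ### Jump operators on a bounded time scale -/

/-- `S` is a time scale with minimum `a` and maximum `b`, consisting of more than one point. -/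
structure IsTimeInterval (S : Set ℝ) (a b : ℝ) : Prop where
  isClosed : IsClosed S
  isLeast : IsLeast S a
  isGreatest : IsGreatest S b
  lt : a < b

/-- The first point of `S` that is not before `s`. The map `s ↦ g (nextPoint S s)` extends a
function `g` on `S` to the interval `[min S, max S]`, with the value `g t` on the gap to the left of a
left-scattered point `t`; its Lebesgue integral is the nabla integral of `g`. -/
noncomputable def nextPoint (S : Set ℝ) (s : ℝ) : ℝ := sInf (S ∩ Ici s)

lemma rho_le (S : Set ℝ) (t : ℝ) : rho S t ≤ t := by
  unfold rho
  split_ifs with h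
  · exact csSup_le h fun x hx => hx.2.le
  · exact le_rfl

lemma le_rho (hr : r ∈ S) (h : r < t) : r ≤ rho S t := by
  have hne : (S ∩ Iio t).Nonempty := ⟨r, hr, h⟩
  rw [rho, if_pos hne]
  exact le_csSup ⟨t, fun x hx => hx.2.le⟩ ⟨hr, h⟩

/-- Points of `S` accumulate from the left at a left-dense point with a predecessor. -/
lemma exists_mem_Ioo_of_rho_eq (ht : rho S t = t) (hr : r ∈ S) (hrt : r < t) (hst : s < t) :
    ∃ u ∈ S, s < u ∧ u < t := by
  have hne : (S ∩ Iio t).Nonempty := ⟨r, hr, hrt⟩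
  rw [rho, if_pos hne] at ht
  obtain ⟨u, hu, hsu⟩ := exists_lt_of_lt_csSup hne (ht.symm ▸ hst)
  exact ⟨u, hu.1, hsu, hu.2⟩

/-- Points of `S` accumulate from the right at a right-dense point with a successor. -/
lemma exists_mem_Ioo_of_sigma_eq (ht : sigma S t = t) (hr : r ∈ S) (htr : t < r) (hts : t < s) :
    ∃ u ∈ S, t < u ∧ u < s := by
  have hne : (S ∩ Ioi t).Nonempty := ⟨r, hr, htr⟩
  rw [sigma, if_pos hne] at ht
  obtain ⟨u, hu, hsu⟩ := exists_lt_of_csInf_lt hne (ht.symm ▸ hts)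
  exact ⟨u, hu.1, hu.2, hsu⟩

lemma le_sigma (S : Set ℝ) (t : ℝ) : t ≤ sigma S t := by
  unfold sigma
  split_ifs with h
  · exact le_csInf h fun x hx => hx.2.le
  · exact le_rfl

lemma sigma_le (hr : r ∈ S) (h : t < r) : sigma S t ≤ r := by
  have hne : (S ∩ Ioi t).Nonempty := ⟨r, hr, h⟩
  rw [sigma, if_pos hne]
  exact csInf_le ⟨t, fun x hx => hx.2.le⟩ ⟨hr, h⟩

lemma nhdsWithin_Iio_eq_bot (ht : rho S t < t) : 𝓝[S ∩ Iio t] t = ⊥ := by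
  rw [← empty_mem_iff_bot]
  filter_upwards [self_mem_nhdsWithin, mem_nhdsWithin_of_mem_nhds (Ioi_mem_nhds ht)] with s hs hs'
  exact absurd (le_rho hs.1 hs.2) (not_le.2 hs')

lemma nhdsWithin_Ioi_eq_bot (ht : t < sigma S t) : 𝓝[S ∩ Ioi t] t = ⊥ := by
  rw [← empty_mem_iff_bot]
  filter_upwards [self_mem_nhdsWithin, mem_nhdsWithin_of_mem_nhds (Iio_mem_nhds ht)] with s hs hs'
  exact absurd (sigma_le hs.1 hs.2) (not_le.2 hs')

lemma nhdsWithin_eq_sup (ht : t ∈ S) :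
    𝓝[S] t = 𝓝[S ∩ Iio t] t ⊔ pure t ⊔ 𝓝[S ∩ Ioi t] t := by
  have h : S = (S ∩ Iio t) ∪ {t} ∪ (S ∩ Ioi t) := by
    ext s
    rcases lt_trichotomy s t with h | h | h <;> simp [h, h.le, not_lt.2, ht, ne_of_lt, ne_of_gt]
  conv_lhs => rw [h, nhdsWithin_union, nhdsWithin_union, nhdsWithin_singleton]

lemma sigma_eq_of_isLeast_of_mem (ha : IsLeast S a) (h : a ∈ lowerKappa S) : sigma S a = a :=
  le_antisymm (not_lt.1 fun h' => h.2 ⟨ha, h'⟩) (le_sigma S a)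

namespace IsTimeInterval

variable (h : IsTimeInterval S a b)
include h

lemma left_mem : a ∈ S := h.isLeast.1

lemma right_mem : b ∈ S := h.isGreatest.1

lemma subset_Icc : S ⊆ Icc a b := fun _ hs => ⟨h.isLeast.2 hs, h.isGreatest.2 hs⟩

lemma isCompact : IsCompact S := isCompact_Icc.of_isClosed_subset h.isClosed h.subset_Icc

lemma rho_mem (ht : t ∈ S) : rho S t ∈ S := by
  unfold rho
  split_ifs with hne
  · exact h.isClosed.closure_subset_iff.2 inter_subset_left
      (csSup_mem_closure hne ⟨t, fun x hx => hx.2.le⟩)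
  · exact ht

lemma rho_left : rho S a = a :=
  if_neg fun ⟨_, hs, hs'⟩ => not_lt.2 (h.isLeast.2 hs) hs'

lemma sigma_left_mem : sigma S a ∈ S := by
  have hne : (S ∩ Ioi a).Nonempty := ⟨b, h.right_mem, h.lt⟩
  rw [sigma, if_pos hne]
  exact h.isClosed.closure_subset_iff.2 inter_subset_left
    (csInf_mem_closure hne ⟨a, fun x hx => hx.2.le⟩)

lemma mem_lowerKappa (ht : t ∈ S) (hat : t ≠ a) : t ∈ lowerKappa S :=
  ⟨ht, fun h' => hat (h'.1.unique h.isLeast)⟩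

lemma right_mem_lowerKappa : b ∈ lowerKappa S := h.mem_lowerKappa h.right_mem h.lt.ne'

lemma eq_left_of_notMem_lowerKappa (ht : t ∈ S) (hk : t ∉ lowerKappa S) : t = a := by
  by_contra hne
  exact hk (h.mem_lowerKappa ht hne)

lemma sigma_left_mem_lowerKappa : sigma S a ∈ lowerKappa S := by
  by_contra hk
  have h1 := h.eq_left_of_notMem_lowerKappa h.sigma_left_mem hk
  rw [h1] at hk
  exact hk ⟨h.left_mem, fun h' => h'.2.ne' h1⟩

/-- The minimum of the time scale is isolated if it is not in `S_κ`. -/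
lemma nhdsWithin_eq_pure (ht : t ∈ S) (hk : t ∉ lowerKappa S) : 𝓝[S] t = pure t := by
  obtain rfl := h.eq_left_of_notMem_lowerKappa ht hk
  have h1 : t < sigma S t := by
    by_contra h'
    exact hk ⟨ht, fun h'' => h' h''.2⟩
  have h2 : S ∩ Iio t = ∅ := by
    ext s
    simpa using fun hs => h.isLeast.2 hs
  rw [nhdsWithin_eq_sup ht, nhdsWithin_Ioi_eq_bot h1, h2]
  simp

lemma accPt (hk : t ∈ lowerKappa S) (ht : rho S t = t) : AccPt t (𝓟 S) := by
  rw [accPt_iff_nhds]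
  intro U hU
  obtain ⟨ε, hε, hεU⟩ := Metric.mem_nhds_iff.1 hU
  rw [Real.ball_eq_Ioo] at hεU
  by_cases hat : t = a
  · subst hat
    obtain ⟨u, hu, htu, hus⟩ := exists_mem_Ioo_of_sigma_eq (s := t + ε)
      (sigma_eq_of_isLeast_of_mem h.isLeast hk) h.right_mem h.lt (by linarith)
    exact ⟨u, ⟨hεU ⟨by linarith, hus⟩, hu⟩, htu.ne'⟩
  · obtain ⟨u, hu, htu, hus⟩ := exists_mem_Ioo_of_rho_eq (s := t - ε) ht h.left_mem
      (lt_of_le_of_ne (h.isLeast.2 hk.1) (Ne.symm hat)) (by linarith)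
    exact ⟨u, ⟨hεU ⟨htu, by linarith⟩, hu⟩, hus.ne⟩

lemma tendsto_rho_Ioi (ht : t ∈ S) : Tendsto (rho S) (𝓝[S ∩ Ioi t] t) (𝓝[S] t) := by
  refine tendsto_nhdsWithin_iff.2 ⟨?_, ?_⟩
  · refine tendsto_of_tendsto_of_tendsto_of_le_of_le' tendsto_const_nhds
      (tendsto_id.mono_left nhdsWithin_le_nhds) ?_ (Eventually.of_forall (rho_le S))
    filter_upwards [self_mem_nhdsWithin] with s hs using le_rho ht hs.2
  · filter_upwards [self_mem_nhdsWithin] with s hs using h.rho_mem hs.1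

lemma tendsto_rho (ht : t ∈ S) (hd : rho S t = t) : Tendsto (rho S) (𝓝[S] t) (𝓝[S] t) := by
  rw [nhdsWithin_eq_sup (S := S) ht, tendsto_sup, tendsto_sup, ← nhdsWithin_eq_sup ht]
  refine ⟨⟨?_, ?_⟩, h.tendsto_rho_Ioi ht⟩
  · refine tendsto_nhdsWithin_iff.2 ⟨?_, ?_⟩
    · refine tendsto_order.2 ⟨fun u hu => ?_, fun u hu => ?_⟩
      · by_cases hat : t = a
        · filter_upwards [self_mem_nhdsWithin] with s hs
          exact absurd hs.2 (not_lt.2 (hat ▸ h.isLeast.2 hs.1))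
        · obtain ⟨r, hr, hur, hrt⟩ := exists_mem_Ioo_of_rho_eq hd h.left_mem
            (lt_of_le_of_ne (h.isLeast.2 ht) (Ne.symm hat)) hu
          filter_upwards [mem_nhdsWithin_of_mem_nhds (Ioi_mem_nhds hrt)] with s hs
          exact hur.trans_le (le_rho hr hs)
      · filter_upwards [self_mem_nhdsWithin] with s hs
        exact (rho_le S s).trans_lt (lt_trans hs.2 hu)
    · filter_upwards [self_mem_nhdsWithin] with s hs using h.rho_mem hs.1
  · rw [tendsto_pure_left]
    intro U hU
    rw [hd]
    exact mem_of_mem_nhdsWithin ht hU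

lemma bddBelow_inter (s : ℝ) : BddBelow (S ∩ Ici s) := ⟨a, fun _ hx => h.isLeast.2 hx.1⟩

lemma nextPoint_mem_inter (hs : s ≤ b) : nextPoint S s ∈ S ∩ Ici s :=
  (h.isClosed.inter isClosed_Ici).csInf_mem ⟨b, h.right_mem, hs⟩ (h.bddBelow_inter s)

lemma nextPoint_mem (hs : s ≤ b) : nextPoint S s ∈ S := (h.nextPoint_mem_inter hs).1

lemma le_nextPoint (hs : s ≤ b) : s ≤ nextPoint S s := (h.nextPoint_mem_inter hs).2

lemma nextPoint_le (hr : r ∈ S) (hs : s ≤ r) : nextPoint S s ≤ r :=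
  csInf_le (h.bddBelow_inter s) ⟨hr, hs⟩

lemma nextPoint_mem_lowerKappa (hs : s ∈ Ioc a b) : nextPoint S s ∈ lowerKappa S :=
  h.mem_lowerKappa (h.nextPoint_mem hs.2) (hs.1.trans_le (h.le_nextPoint hs.2)).ne'

/-- On the gap to the left of a left-scattered point `t` the next point is `t`. -/
lemma nextPoint_eq_of_mem_Ioc (ht : t ∈ S) (hs : s ∈ Ioc (rho S t) t) : nextPoint S s = t := by
  have hsb : s ≤ b := hs.2.trans (h.isGreatest.2 ht)
  refine le_antisymm (h.nextPoint_le ht hs.2) (not_lt.1 fun h' => ?_)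
  exact absurd (le_rho (h.nextPoint_mem hsb) h') (not_le.2 (hs.1.trans_le (h.le_nextPoint hsb)))

lemma monotoneOn_nextPoint : MonotoneOn (nextPoint S) (Iic b) := fun _ _ _ hy hxy =>
  h.nextPoint_le (h.nextPoint_mem hy) (hxy.trans (h.le_nextPoint hy))

end IsTimeInterval

/-! ### Calculus of nabla derivatives -/

lemma hasNablaDerivAt_iff_eventually : HasNablaDerivAt S g d t ↔ ∀ ε : ℝ, 0 < ε →
    ∀ᶠ s in 𝓝[S] t, |g (rho S t) - g s - d * (rho S t - s)| ≤ ε * |rho S t - s| := by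
  refine forall₂_congr fun ε _ => ?_
  rw [eventually_iff, mem_nhdsWithin_iff_exists_mem_nhds_inter]
  rfl

/-- At a left-dense point the nabla derivative is the derivative relative to `S`. -/
lemma hasNablaDerivAt_iff_of_rho_eq (ht : rho S t = t) :
    HasNablaDerivAt S g d t ↔ HasDerivWithinAt g d S t := by
  rw [hasNablaDerivAt_iff_eventually, hasDerivWithinAt_iff_isLittleO, Asymptotics.isLittleO_iff, ht]
  refine forall_congr' fun ε => forall_congr' fun _ => eventually_congr (Eventually.of_forall ?_)
  intro s
  rw [Real.norm_eq_abs, Real.norm_eq_abs, abs_sub_comm s t, ← abs_neg, smul_eq_mul]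
  ring_nf

/-- At a left-scattered point the nabla derivative is the difference quotient over the gap to the
left, and its existence amounts to continuity. -/
lemma hasNablaDerivAt_iff_of_rho_lt (hS : t ∈ S) (ht : rho S t < t) :
    HasNablaDerivAt S g d t ↔
      ContinuousWithinAt g S t ∧ g t - g (rho S t) = d * (t - rho S t) := by
  rw [hasNablaDerivAt_iff_eventually]
  set q := rho S t
  have hid : Tendsto (fun s : ℝ => s) (𝓝[S] t) (𝓝 t) := tendsto_id.mono_left nhdsWithin_le_nhds
  have hq : Tendsto (fun s : ℝ => |q - s|) (𝓝[S] t) (𝓝 |q - t|) :=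
    (tendsto_const_nhds.sub hid).abs
  constructor
  · intro H
    have h0 : g t - g q = d * (t - q) := by
      have h1 : |g q - g t - d * (q - t)| ≤ 0 := by
        refine le_of_forall_pos_le_add fun ε hε => ?_
        have hp : 0 < |q - t| := abs_pos.2 (by linarith)
        have := (H (ε / |q - t|) (by positivity)).self_of_nhdsWithin hS
        rwa [div_mul_cancel₀ _ hp.ne', ← zero_add ε] at this
      have := abs_nonpos_iff.1 h1
      linarith
    refine ⟨?_, h0⟩
    have hk : Tendsto (fun s => g q - g s - d * (q - s)) (𝓝[S] t) (𝓝 0) := by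
      rw [Metric.tendsto_nhds]
      intro ε hε
      have hC : (0 : ℝ) < |q - t| + 1 := by positivity
      filter_upwards [H (ε / 2 / (|q - t| + 1)) (by positivity),
        hq.eventually (gt_mem_nhds (show |q - t| < |q - t| + 1 by linarith))] with s h1 h2
      rw [Real.dist_eq, sub_zero]
      refine h1.trans_lt ?_
      calc ε / 2 / (|q - t| + 1) * |q - s| ≤ ε / 2 / (|q - t| + 1) * (|q - t| + 1) := by gcongr
        _ = ε / 2 := by field_simp
        _ < ε := by linarith
    have h2 : Tendsto (fun s => g q - d * (q - s) - (g q - g s - d * (q - s))) (𝓝[S] t)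
        (𝓝 (g q - d * (q - t) - 0)) :=
      (tendsto_const_nhds.sub ((tendsto_const_nhds.sub hid).const_mul d)).sub hk
    have h3 : g q - d * (q - t) - 0 = g t := by linarith
    rw [h3] at h2
    exact h2.congr fun s => by ring
  · rintro ⟨hc, h0⟩ ε hε
    have h1 : Tendsto (fun s => |g q - g s - d * (q - s)| - ε * |q - s|) (𝓝[S] t)
        (𝓝 (|g q - g t - d * (q - t)| - ε * |q - t|)) :=
      ((tendsto_const_nhds.sub hc).sub ((tendsto_const_nhds.sub hid).const_mul d)).abs.sub
        (hq.const_mul ε)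
    have h2 : |g q - g t - d * (q - t)| - ε * |q - t| < 0 := by
      have hp : 0 < |q - t| := abs_pos.2 (by linarith)
      have : g q - g t - d * (q - t) = 0 := by linarith
      rw [this, abs_zero]
      have := mul_pos hε hp
      linarith
    filter_upwards [h1.eventually (gt_mem_nhds h2)] with s hs
    linarith

lemma rho_eq_or_lt (S : Set ℝ) (t : ℝ) : rho S t = t ∨ rho S t < t := (rho_le S t).eq_or_lt

lemma HasNablaDerivAt.continuousWithinAt (hS : t ∈ S) (hg : HasNablaDerivAt S g d t) :
    ContinuousWithinAt g S t := by
  rcases rho_eq_or_lt S t with ht | ht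
  · exact ((hasNablaDerivAt_iff_of_rho_eq ht).1 hg).continuousWithinAt
  · exact ((hasNablaDerivAt_iff_of_rho_lt hS ht).1 hg).1

lemma HasNablaDerivAt.add (hS : t ∈ S) (hg : HasNablaDerivAt S g d t)
    (hk : HasNablaDerivAt S k e t) : HasNablaDerivAt S (fun s => g s + k s) (d + e) t := by
  rcases rho_eq_or_lt S t with ht | ht
  · rw [hasNablaDerivAt_iff_of_rho_eq ht] at *
    exact hg.add hk
  · rw [hasNablaDerivAt_iff_of_rho_lt hS ht] at *
    exact ⟨hg.1.add hk.1, by linear_combination hg.2 + hk.2⟩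

lemma HasNablaDerivAt.const_mul (hS : t ∈ S) (c : ℝ) (hg : HasNablaDerivAt S g d t) :
    HasNablaDerivAt S (fun s => c * g s) (c * d) t := by
  rcases rho_eq_or_lt S t with ht | ht
  · rw [hasNablaDerivAt_iff_of_rho_eq ht] at *
    exact hg.const_mul c
  · rw [hasNablaDerivAt_iff_of_rho_lt hS ht] at *
    exact ⟨continuousWithinAt_const.mul hg.1, by linear_combination c * hg.2⟩

/-- The nabla product rule `(g k)^∇ = g^∇ k^ρ + g k^∇`. -/
lemma HasNablaDerivAt.mul (hS : t ∈ S) (hg : HasNablaDerivAt S g d t)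
    (hk : HasNablaDerivAt S k e t) :
    HasNablaDerivAt S (fun s => g s * k s) (d * k (rho S t) + g t * e) t := by
  rcases rho_eq_or_lt S t with ht | ht
  · rw [hasNablaDerivAt_iff_of_rho_eq ht] at *
    rw [ht]
    exact hg.mul hk
  · rw [hasNablaDerivAt_iff_of_rho_lt hS ht] at *
    exact ⟨hg.1.mul hk.1, by linear_combination k (rho S t) * hg.2 + g t * hk.2⟩

lemma hasNablaDerivAt_of_hasDerivAt (hS : t ∈ S) (hc : Continuous g) (hd : HasDerivAt g d t)
    (hs : g t - g (rho S t) = d * (t - rho S t)) : HasNablaDerivAt S g d t := by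
  rcases rho_eq_or_lt S t with ht | ht
  · exact (hasNablaDerivAt_iff_of_rho_eq ht).2 hd.hasDerivWithinAt
  · exact (hasNablaDerivAt_iff_of_rho_lt hS ht).2 ⟨hc.continuousWithinAt, hs⟩

/-- The nabla derivative at `t` only depends on the values near `t` and at `ρ(t)`. -/
lemma HasNablaDerivAt.congr (hg : HasNablaDerivAt S g d t) (h1 : g (rho S t) = k (rho S t))
    (h2 : g =ᶠ[𝓝[S] t] k) : HasNablaDerivAt S k d t := by
  rw [hasNablaDerivAt_iff_eventually] at *
  intro ε hε
  filter_upwards [hg ε hε, h2] with s hs h2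
  rwa [← h1, ← h2]

lemma IsTimeInterval.hasNablaDerivAt_unique (h : IsTimeInterval S a b) (hk : t ∈ lowerKappa S)
    (h1 : HasNablaDerivAt S g d t) (h2 : HasNablaDerivAt S g e t) : d = e := by
  rcases rho_eq_or_lt S t with ht | ht
  · rw [hasNablaDerivAt_iff_of_rho_eq ht] at *
    exact (h.accPt hk ht).uniqueDiffWithinAt.eq_deriv S h1 h2
  · rw [hasNablaDerivAt_iff_of_rho_lt hk.1 ht] at *
    exact mul_right_cancel₀ (sub_pos.2 ht).ne' (h1.2.symm.trans h2.2)

lemma IsTimeInterval.nablaDeriv_eq (h : IsTimeInterval S a b) (hk : t ∈ lowerKappa S)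
    (hg : HasNablaDerivAt S g d t) : nablaDeriv S g t = d := by
  have hex : ∃ d, HasNablaDerivAt S g d t := ⟨d, hg⟩
  rw [nablaDeriv, dif_pos hex]
  exact h.hasNablaDerivAt_unique hk hex.choose_spec hg

lemma C1ld.hasNablaDerivAt (hg : C1ld S g) (hk : t ∈ lowerKappa S) :
    HasNablaDerivAt S g (nablaDeriv S g t) t := by
  rw [nablaDeriv, dif_pos (hg.1 t hk)]
  exact (hg.1 t hk).choose_spec

namespace IsTimeInterval

variable (h : IsTimeInterval S a b)
include h

lemma continuousOn_of_hasNablaDerivAt {g' : ℝ → ℝ}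
    (hg : ∀ t ∈ lowerKappa S, HasNablaDerivAt S g (g' t) t) : ContinuousOn g S := by
  intro t ht
  by_cases hk : t ∈ lowerKappa S
  · exact (hg t hk).continuousWithinAt ht
  · rw [ContinuousWithinAt, h.nhdsWithin_eq_pure ht hk]
    exact tendsto_pure_nhds g t

/-- Mean value inequality for vanishing nabla derivative. The proof is an induction going down from
`b`: in this direction, the difference quotient controls a jump over a gap, and continuity suffices
for the passage to a limit point from the right. -/
lemma abs_sub_le_of_hasNablaDerivAt_zero (hg : ∀ t ∈ lowerKappa S, HasNablaDerivAt S g 0 t)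
    {ε : ℝ} (hε : 0 < ε) (ht : t ∈ S) : |g b - g t| ≤ ε * (b - t) := by
  have hc : ContinuousOn g S := h.continuousOn_of_hasNablaDerivAt hg
  set E : Set ℝ := {t ∈ S | |g b - g t| ≤ ε * (b - t)} with hE
  have hEc : IsClosed E := h.isClosed.isClosed_le (continuousOn_const.sub hc).abs
    (continuousOn_const.mul (continuousOn_const.sub continuousOn_id))
  set D : Set ℝ := {t ∈ S | ∀ s ∈ S, t ≤ s → s ∈ E} with hD
  have hbE : b ∈ E := ⟨h.right_mem, by simp⟩
  have hbD : b ∈ D := ⟨h.right_mem, fun s hs hbs => by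
    rwa [le_antisymm (h.isGreatest.2 hs) hbs]⟩
  have hDb : BddBelow D := ⟨a, fun s hs => h.isLeast.2 hs.1⟩
  have hDE : D ⊆ E := fun s hs => hs.2 s hs.1 le_rfl
  set m := sInf D with hm
  have hmE : m ∈ E := hEc.closure_subset_iff.2 hDE (csInf_mem_closure ⟨b, hbD⟩ hDb)
  have hmD : m ∈ D := by
    refine ⟨hmE.1, fun s hs hms => ?_⟩
    rcases hms.eq_or_lt with rfl | hms
    · exact hmE
    · obtain ⟨u, hu, hus⟩ := exists_lt_of_csInf_lt ⟨b, hbD⟩ hms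
      exact hu.2 s hs hus.le
  suffices m = a from (hmD.2 t ht (this ▸ h.isLeast.2 ht)).2
  by_contra hma
  have hmk := h.mem_lowerKappa hmE.1 hma
  have ham : a < m := lt_of_le_of_ne (h.isLeast.2 hmE.1) (Ne.symm hma)
  rcases rho_eq_or_lt S m with hr | hr
  · have h1 := hasNablaDerivAt_iff_eventually.1 (hg m hmk) ε hε
    obtain ⟨U, hU, hUs⟩ := mem_nhdsWithin_iff_exists_mem_nhds_inter.1 h1
    obtain ⟨η, hη, hηU⟩ := Metric.mem_nhds_iff.1 hU
    rw [Real.ball_eq_Ioo] at hηU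
    obtain ⟨r, hrS, hr1, hr2⟩ := exists_mem_Ioo_of_rho_eq (s := m - η) hr h.left_mem ham
      (by linarith)
    have hrD : r ∈ D := by
      refine ⟨hrS, fun s hs hrs => ?_⟩
      by_cases hsm : m ≤ s
      · exact hmD.2 s hs hsm
      · push Not at hsm
        have h2 : |g (rho S m) - g s - 0 * (rho S m - s)| ≤ ε * |rho S m - s| :=
          hUs ⟨hηU ⟨by linarith, by linarith⟩, hs⟩
        rw [hr, zero_mul, sub_zero, abs_of_pos (sub_pos.2 hsm)] at h2
        refine ⟨hs, ?_⟩
        have h3 := abs_sub_le (g b) (g m) (g s)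
        have h4 := hmE.2
        linarith
    exact absurd (csInf_le hDb hrD) (not_le.2 hr2)
  · have h1 := ((hasNablaDerivAt_iff_of_rho_lt hmE.1 hr).1 (hg m hmk)).2
    have hrD : rho S m ∈ D := by
      refine ⟨h.rho_mem hmE.1, fun s hs hrs => ?_⟩
      by_cases hsm : m ≤ s
      · exact hmD.2 s hs hsm
      · push Not at hsm
        have h2 : s = rho S m := le_antisymm (le_rho hs hsm) hrs
        refine ⟨hs, ?_⟩
        have h3 : g s = g m := by rw [h2]; linarith
        rw [h3]
        exact hmE.2.trans (by gcongr)
    exact absurd (csInf_le hDb hrD) (not_le.2 hr)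

lemma eq_of_hasNablaDerivAt_zero (hg : ∀ t ∈ lowerKappa S, HasNablaDerivAt S g 0 t)
    (ht : t ∈ S) : g t = g b := by
  have h1 : |g b - g t| ≤ 0 := by
    refine le_of_forall_pos_le_add fun ε hε => ?_
    have hp : 0 < b - a := sub_pos.2 h.lt
    refine (h.abs_sub_le_of_hasNablaDerivAt_zero hg (ε := ε / (b - a)) (by positivity) ht).trans ?_
    calc ε / (b - a) * (b - t) ≤ ε / (b - a) * (b - a) := by
          gcongr; exact h.isLeast.2 ht
      _ = 0 + ε := by field_simp; ring
  linarith [abs_nonpos_iff.1 h1]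

/-- Two nabla antiderivatives of the same function have the same increments. -/
lemma sub_eq_sub_of_isNablaAntideriv {G H : ℝ → ℝ} (hG : IsNablaAntideriv S g G)
    (hH : IsNablaAntideriv S g H) (hs : s ∈ S) (ht : t ∈ S) : G t - G s = H t - H s := by
  have h0 : ∀ t ∈ lowerKappa S, HasNablaDerivAt S (fun t => G t + -1 * H t) 0 t := fun t ht => by
    have := (hG t ht).add ht.1 ((hH t ht).const_mul ht.1 (-1))
    rwa [neg_one_mul, add_neg_cancel] at this
  have h1 := h.eq_of_hasNablaDerivAt_zero h0 hs
  have h2 := h.eq_of_hasNablaDerivAt_zero h0 ht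
  linarith

end IsTimeInterval

/-! ### ld-continuous functions -/

lemma LdContinuous.add (hg : LdContinuous S g) (hk : LdContinuous S k) :
    LdContinuous S (fun t => g t + k t) := by
  refine ⟨fun t ht hr => (hg.1 t ht hr).add (hk.1 t ht hr), fun t ht hr => ?_⟩
  obtain ⟨l, hl⟩ := hg.2 t ht hr
  obtain ⟨m, hm⟩ := hk.2 t ht hr
  exact ⟨l + m, hl.add hm⟩

lemma LdContinuous.mul (hg : LdContinuous S g) (hk : LdContinuous S k) :
    LdContinuous S (fun t => g t * k t) := by
  refine ⟨fun t ht hr => (hg.1 t ht hr).mul (hk.1 t ht hr), fun t ht hr => ?_⟩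
  obtain ⟨l, hl⟩ := hg.2 t ht hr
  obtain ⟨m, hm⟩ := hk.2 t ht hr
  exact ⟨l * m, hl.mul hm⟩

lemma ldContinuous_of_continuousOn (hg : ContinuousOn g S) : LdContinuous S g :=
  ⟨fun t ht _ => hg t ht, fun t ht _ => ⟨g t, (hg t ht).mono_left
    (nhdsWithin_mono t inter_subset_left)⟩⟩

lemma LdContinuous.const_mul (c : ℝ) (hg : LdContinuous S g) : LdContinuous S (fun t => c * g t) :=
  (ldContinuous_of_continuousOn continuousOn_const).mul hg

lemma LdContinuous.exists_tendsto_Ioi (hg : LdContinuous S g) (ht : t ∈ S) :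
    ∃ l, Tendsto g (𝓝[S ∩ Ioi t] t) (𝓝 l) := by
  rcases (le_sigma S t).eq_or_lt with hs | hs
  · exact hg.2 t ht hs.symm
  · exact ⟨0, by simp [nhdsWithin_Ioi_eq_bot hs]⟩

namespace IsTimeInterval

variable (h : IsTimeInterval S a b)
include h

lemma ldContinuous_comp_rho (hg : ContinuousOn g S) : LdContinuous S (fun t => g (rho S t)) := by
  refine ⟨fun t ht hr => ?_, fun t ht _ => ⟨g t, ?_⟩⟩
  · have h1 : Tendsto g (𝓝[S] t) (𝓝 (g (rho S t))) := by
      rw [hr]; exact hg t ht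
    exact Tendsto.comp h1 (h.tendsto_rho ht hr)
  · have h1 : Tendsto g (𝓝[S] t) (𝓝 (g t)) := hg t ht
    exact h1.comp (h.tendsto_rho_Ioi ht)

/-- Values outside `S_κ` do not matter for ld-continuity. -/
lemma ldContinuous_congr (hg : LdContinuous S g) (hgk : EqOn g k (lowerKappa S)) :
    LdContinuous S k := by
  have hne : ∀ t ∈ S, ∀ᶠ s in 𝓝[S] t, s ∈ lowerKappa S ∨ s = t := by
    intro t ht
    by_cases hk : a ∈ lowerKappa S
    · filter_upwards [self_mem_nhdsWithin] with s hs
      by_contra hc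
      push Not at hc
      exact hc.1 (h.eq_left_of_notMem_lowerKappa hs hc.1 ▸ hk)
    · by_cases hta : t = a
      · subst hta
        rw [h.nhdsWithin_eq_pure ht hk]
        simp
      · filter_upwards [self_mem_nhdsWithin,
          mem_nhdsWithin_of_mem_nhds (isOpen_ne.mem_nhds hta)] with s hs hsa
        exact Or.inl (h.mem_lowerKappa hs hsa)
  refine ⟨fun t ht hr => ?_, fun t ht hr => ?_⟩
  · by_cases hk : t ∈ lowerKappa S
    · refine (hg.1 t ht hr).congr_of_eventuallyEq ?_ (hgk hk).symm
      filter_upwards [hne t ht] with s hs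
      rcases hs with hs | rfl
      exacts [(hgk hs).symm, (hgk hk).symm]
    · rw [ContinuousWithinAt, h.nhdsWithin_eq_pure ht hk]
      exact tendsto_pure_nhds k t
  · obtain ⟨l, hl⟩ := hg.2 t ht hr
    refine ⟨l, hl.congr' ?_⟩
    filter_upwards [self_mem_nhdsWithin,
      nhdsWithin_mono t inter_subset_left (hne t ht)] with s hs hs'
    rcases hs' with hs' | rfl
    · exact hgk hs'
    · exact absurd (mem_Ioi.1 hs.2) (lt_irrefl _)

lemma exists_bound (hg : LdContinuous S g) : ∃ M, ∀ t ∈ S, |g t| ≤ M := by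
  have hlim : ∀ {l : ℝ} {F : Filter ℝ}, Tendsto g F (𝓝 l) → ∀ᶠ s in F, |g s| ≤ |l| + 1 :=
    fun hF => (hF.abs.eventually (gt_mem_nhds (lt_add_one _))).mono fun s hs => hs.le
  refine h.isCompact.induction_on (p := fun U => ∃ M, ∀ t ∈ U, |g t| ≤ M) ⟨0, by simp⟩
    (fun U V hUV ⟨M, hM⟩ => ⟨M, fun t ht => hM t (hUV ht)⟩) ?_ fun t ht => ?_
  · rintro U V ⟨M, hM⟩ ⟨N, hN⟩
    refine ⟨max M N, fun t ht => ?_⟩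
    rcases ht with ht | ht
    exacts [(hM t ht).trans (le_max_left _ _), (hN t ht).trans (le_max_right _ _)]
  · suffices ∃ M, ∀ᶠ s in 𝓝[S] t, |g s| ≤ M by
      obtain ⟨M, hM⟩ := this
      exact ⟨_, hM, M, fun s hs => hs⟩
    rcases rho_eq_or_lt S t with hr | hr
    · exact ⟨_, hlim (hg.1 t ht hr)⟩
    · obtain ⟨l, hl⟩ := hg.exists_tendsto_Ioi ht
      refine ⟨max |g t| (|l| + 1), ?_⟩
      rw [nhdsWithin_eq_sup ht, nhdsWithin_Iio_eq_bot hr, bot_sup_eq, eventually_sup]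
      refine ⟨?_, (hlim hl).mono fun s hs => hs.trans (le_max_right _ _)⟩
      exact eventually_pure.2 (le_max_left _ _)

/-- An ld-continuous function is continuous off the left-scattered points, which are countably
many. -/
lemma measurable_indicator (hg : LdContinuous S g) : Measurable (S.indicator g) := by
  classical
  set D : Set ℝ := {t ∈ S | 𝓝[S ∩ Iio t] t = ⊥} with hD
  have hDc : D.Countable := countable_setOfPred_isolated_left_within
  have hms : MeasurableSet (S \ (D \ {a})) :=
    h.isClosed.measurableSet.diff (hDc.mono sdiff_subset).measurableSet
  have hcont : ContinuousOn g (S \ (D \ {a})) := by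
    intro t ht
    refine (hg.1 t ht.1 ?_).mono sdiff_subset
    rcases rho_eq_or_lt S t with hr | hr
    · exact hr
    · have hta : t = a := by
        by_contra hta
        exact ht.2 ⟨⟨ht.1, nhdsWithin_Iio_eq_bot hr⟩, hta⟩
      rw [hta, h.rho_left]
  have h1 : Measurable ((S \ (D \ {a})).piecewise g fun _ => 0) :=
    hcont.measurable_piecewise continuousOn_const hms
  refine h1.measurable_of_countable_ne (hDc.mono fun t ht => ?_)
  by_contra htD
  refine ht ?_
  by_cases htS : t ∈ S
  · rw [piecewise_eq_of_mem _ _ _ (mem_sdiff_of_mem htS fun h' => htD h'.1), indicator_of_mem htS]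
  · rw [piecewise_eq_of_notMem _ _ _ fun h' => htS h'.1, indicator_of_notMem htS]

lemma aestronglyMeasurable_comp_nextPoint (hg : LdContinuous S g) :
    AEStronglyMeasurable (fun s => g (nextPoint S s)) (volume.restrict (Ι a b)) := by
  have h1 : Measurable fun s => nextPoint S (min s b) := by
    refine Monotone.measurable fun x y hxy => h.monotoneOn_nextPoint (mem_Iic.2 (min_le_right _ _))
      (mem_Iic.2 (min_le_right _ _)) (min_le_min_right b hxy)
  refine ((h.measurable_indicator hg).comp h1).aestronglyMeasurable.congr ?_
  filter_upwards [ae_restrict_mem measurableSet_uIoc] with s hs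
  rw [uIoc_of_le h.lt.le] at hs
  simp [min_eq_left hs.2, h.nextPoint_mem hs.2]

/-! ### The nabla integral as a Lebesgue integral -/

lemma intervalIntegrable (hg : LdContinuous S g) :
    IntervalIntegrable (fun s => g (nextPoint S s)) volume a b := by
  obtain ⟨M, hM⟩ := h.exists_bound hg
  refine (intervalIntegrable_const (c := M)).mono_fun
    (h.aestronglyMeasurable_comp_nextPoint hg) ?_
  filter_upwards [ae_restrict_mem measurableSet_uIoc] with s hs
  rw [uIoc_of_le h.lt.le] at hs
  exact (hM _ (h.nextPoint_mem hs.2)).trans (le_abs_self M)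

lemma intervalIntegrable_of_mem (hg : LdContinuous S g) (hr : r ∈ Icc a b) (hs : s ∈ Icc a b) :
    IntervalIntegrable (fun s => g (nextPoint S s)) volume r s :=
  (h.intervalIntegrable hg).mono_set (by
    rw [uIcc_of_le h.lt.le]; exact uIcc_subset_Icc hr hs)

/-- Every ld-continuous function has a nabla antiderivative. -/
lemma isNablaAntideriv_integral (hg : LdContinuous S g) :
    IsNablaAntideriv S g (fun t => ∫ s in a..t, g (nextPoint S s)) := by
  intro t hk
  have ht := hk.1
  have ha := left_mem_Icc.2 h.lt.le
  have hsub : ∀ u ∈ S, (∫ s in a..u, g (nextPoint S s)) - ∫ s in a..t, g (nextPoint S s) =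
      ∫ s in t..u, g (nextPoint S s) := fun u hu =>
    intervalIntegral.integral_interval_sub_left
      (h.intervalIntegrable_of_mem hg ha (h.subset_Icc hu))
      (h.intervalIntegrable_of_mem hg ha (h.subset_Icc ht))
  rcases rho_eq_or_lt S t with hr | hr
  · rw [hasNablaDerivAt_iff_eventually, hr]
    intro ε hε
    have h1 : ∀ᶠ s in 𝓝[S] t, |g s - g t| < ε := by
      have := Metric.tendsto_nhds.1 (hg.1 t ht hr) ε hε
      simpa only [Real.dist_eq] using this
    obtain ⟨U, hU, hUs⟩ := mem_nhdsWithin_iff_exists_mem_nhds_inter.1 h1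
    obtain ⟨η, hη, hηU⟩ := Metric.mem_nhds_iff.1 hU
    rw [Real.ball_eq_Ioo] at hηU
    filter_upwards [self_mem_nhdsWithin, mem_nhdsWithin_of_mem_nhds
      (Ioo_mem_nhds (show t - η < t by linarith) (show t < t + η by linarith))] with u hu huη
    have h2 := h.intervalIntegrable_of_mem hg (h.subset_Icc ht) (h.subset_Icc hu)
    have h3 : ‖∫ s in t..u, (g (nextPoint S s) - g t)‖ ≤ ε * |u - t| := by
      refine intervalIntegral.norm_integral_le_of_norm_le_const fun s hs => ?_
      have hsb : s ≤ b :=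
        (uIoc_subset_uIcc hs).2.trans (max_le (h.isGreatest.2 ht) (h.isGreatest.2 hu))
      -- the next point after `s` still lies between `t` and `u`
      have h4 : nextPoint S s ∈ Ioo (t - η) (t + η) := by
        rcases mem_uIoc.1 hs with hs | hs
        · exact ⟨by linarith [h.le_nextPoint hsb, hs.1], (h.nextPoint_le hu hs.2).trans_lt huη.2⟩
        · exact ⟨by linarith [h.le_nextPoint hsb, hs.1, huη.1],
            (h.nextPoint_le ht hs.2).trans_lt (by linarith)⟩
      exact le_of_lt (hUs ⟨hηU h4, h.nextPoint_mem hsb⟩)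
    rw [intervalIntegral.integral_sub h2 intervalIntegrable_const,
      intervalIntegral.integral_const, ← hsub u hu, smul_eq_mul, Real.norm_eq_abs] at h3
    rw [abs_sub_comm t u, ← abs_neg]
    refine le_of_eq_of_le ?_ h3
    congr 1
    ring
  · refine (hasNablaDerivAt_iff_of_rho_lt ht hr).2 ⟨?_, ?_⟩
    · have h1 := intervalIntegral.continuousOn_primitive_interval (a := a) (b := b)
        (f := fun s => g (nextPoint S s)) (μ := volume)
        (((intervalIntegrable_iff_integrableOn_Icc_of_le h.lt.le).1
          (h.intervalIntegrable hg)).mono_set (uIcc_of_le h.lt.le).subset)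
      rw [uIcc_of_le h.lt.le] at h1
      exact (h1 t (h.subset_Icc ht)).mono h.subset_Icc
    · have h1 := hsub _ (h.rho_mem ht)
      rw [intervalIntegral.integral_symm (rho S t) t] at h1
      have h2 : ∫ s in rho S t..t, g (nextPoint S s) = ∫ s in rho S t..t, g t := by
        refine intervalIntegral.integral_congr_ae (Eventually.of_forall fun s hs => ?_)
        rw [uIoc_of_le hr.le] at hs
        rw [h.nextPoint_eq_of_mem_Ioc ht hs]
      rw [h2, intervalIntegral.integral_const, smul_eq_mul] at h1
      linarith

lemma integral_nextPoint_eq_sub {G : ℝ → ℝ} (hg : LdContinuous S g) (hG : IsNablaAntideriv S g G)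
    (ht : t ∈ S) : ∫ s in a..t, g (nextPoint S s) = G t - G a := by
  have := h.sub_eq_sub_of_isNablaAntideriv (h.isNablaAntideriv_integral hg) hG h.left_mem ht
  rwa [intervalIntegral.integral_same, sub_zero] at this

lemma nablaIntegral_eq (hg : LdContinuous S g) (ht : t ∈ S) :
    nablaIntegral S g a t = ∫ s in a..t, g (nextPoint S s) := by
  have hex : ∃ G, IsNablaAntideriv S g G := ⟨_, h.isNablaAntideriv_integral hg⟩
  rw [nablaIntegral, dif_pos hex, h.integral_nextPoint_eq_sub hg hex.choose_spec ht]

lemma nablaIntegral_add (hg : LdContinuous S g) (hk : LdContinuous S k) (ht : t ∈ S) :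
    nablaIntegral S (fun s => g s + k s) a t = nablaIntegral S g a t + nablaIntegral S k a t := by
  have ha := left_mem_Icc.2 h.lt.le
  rw [h.nablaIntegral_eq hg ht, h.nablaIntegral_eq hk ht, h.nablaIntegral_eq (hg.add hk) ht]
  exact intervalIntegral.integral_add (h.intervalIntegrable_of_mem hg ha (h.subset_Icc ht))
    (h.intervalIntegrable_of_mem hk ha (h.subset_Icc ht))

lemma nablaIntegral_const_mul (c : ℝ) (hg : LdContinuous S g) (ht : t ∈ S) :
    nablaIntegral S (fun s => c * g s) a t = c * nablaIntegral S g a t := by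
  rw [h.nablaIntegral_eq hg ht, h.nablaIntegral_eq (hg.const_mul c) ht]
  exact intervalIntegral.integral_const_mul _ _

lemma nablaIntegral_congr (hg : LdContinuous S g) (hk : LdContinuous S k)
    (hgk : EqOn g k (lowerKappa S)) : nablaIntegral S g a b = nablaIntegral S k a b := by
  rw [h.nablaIntegral_eq hg h.right_mem, h.nablaIntegral_eq hk h.right_mem]
  refine intervalIntegral.integral_congr_ae (Eventually.of_forall fun s hs => ?_)
  rw [uIoc_of_le h.lt.le] at hs
  exact hgk (h.nextPoint_mem_lowerKappa hs)

/-- Fundamental theorem of calculus. -/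
lemma nablaIntegral_eq_sub {G : ℝ → ℝ} (hg : LdContinuous S g) (hG : IsNablaAntideriv S g G)
    (ht : t ∈ S) : nablaIntegral S g a t = G t - G a := by
  rw [h.nablaIntegral_eq hg ht, h.integral_nextPoint_eq_sub hg hG ht]

lemma isNablaAntideriv_nablaIntegral (hg : LdContinuous S g) :
    IsNablaAntideriv S g (fun t => nablaIntegral S g a t) := by
  intro t hk
  refine (h.isNablaAntideriv_integral hg t hk).congr
    (h.nablaIntegral_eq hg (h.rho_mem hk.1)).symm ?_
  filter_upwards [self_mem_nhdsWithin] with s hs using (h.nablaIntegral_eq hg hs).symm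

lemma nablaIntegral_self (hg : LdContinuous S g) : nablaIntegral S g a a = 0 := by
  rw [h.nablaIntegral_eq hg h.left_mem, intervalIntegral.integral_same]

/-- An ld-continuous function whose square has integral zero vanishes on `S_κ`: the indefinite
integral of the square is monotone, hence zero, and so is its nabla derivative. -/
lemma eq_zero_of_nablaIntegral_sq (hg : LdContinuous S g)
    (h0 : nablaIntegral S (fun s => g s * g s) a b = 0) (hk : t ∈ lowerKappa S) : g t = 0 := by
  have hgg := hg.mul hg
  have h1 : ∀ s ∈ S, nablaIntegral S (fun s => g s * g s) a s = 0 := by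
    intro s hs
    have has := h.subset_Icc hs
    have h2 := intervalIntegral.integral_add_adjacent_intervals
      (h.intervalIntegrable_of_mem hgg (left_mem_Icc.2 h.lt.le) has)
      (h.intervalIntegrable_of_mem hgg has (right_mem_Icc.2 h.lt.le))
    have h3 : 0 ≤ ∫ u in a..s, g (nextPoint S u) * g (nextPoint S u) :=
      intervalIntegral.integral_nonneg has.1 fun u _ => mul_self_nonneg _
    have h4 : 0 ≤ ∫ u in s..b, g (nextPoint S u) * g (nextPoint S u) :=
      intervalIntegral.integral_nonneg has.2 fun u _ => mul_self_nonneg _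
    rw [h.nablaIntegral_eq hgg h.right_mem] at h0
    rw [h.nablaIntegral_eq hgg hs]
    linarith
  have h2 := h.isNablaAntideriv_nablaIntegral hgg t hk
  have h3 := h2.const_mul hk.1 0
  have h4 := h3.congr (k := fun t => nablaIntegral S (fun s => g s * g s) a t)
    (by rw [h1 _ (h.rho_mem hk.1), zero_mul])
    (by filter_upwards [self_mem_nhdsWithin] with s hs; rw [h1 s hs, zero_mul])
  have h5 := h.hasNablaDerivAt_unique hk h2 h4
  rw [zero_mul] at h5
  exact mul_self_eq_zero.1 h5

end IsTimeInterval

/-! ### The first variation -/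

/-- Chain rule along a line: continuity of the partial derivatives makes `f t` jointly
differentiable. -/
lemma IsLagrangian.hasDerivAt_line {f : ℝ → ℝ → ℝ → ℝ} (hf : IsLagrangian S f) (ht : t ∈ S)
    (y v p q ε : ℝ) :
    HasDerivAt (fun ε => f t (y + ε * p) (v + ε * q))
      (partialY f t (y + ε * p) (v + ε * q) * p + partialV f t (y + ε * p) (v + ε * q) * q) ε := by
  have hy : ∀ u : ℝ × ℝ, HasFDerivAt (fun z => f t z u.2)
      (partialY f t u.1 u.2 • ContinuousLinearMap.id ℝ ℝ) u.1 := fun u =>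
    ((hf.differentiable_y t ht u.1 u.2).hasDerivAt.hasFDerivAt).congr_fderiv
      (by ext; simp [partialY])
  have hv : ∀ u : ℝ × ℝ, HasFDerivAt (fun w => f t u.1 w)
      (partialV f t u.1 u.2 • ContinuousLinearMap.id ℝ ℝ) u.2 := fun u =>
    ((hf.differentiable_v t ht u.1 u.2).hasDerivAt.hasFDerivAt).congr_fderiv
      (by ext; simp [partialV])
  have h1 := (hasStrictFDerivAt_uncurry_coprod (u := (y + ε * p, v + ε * q)) (f := f t)
    (f₁ := fun z w => partialY f t z w • ContinuousLinearMap.id ℝ ℝ)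
    (f₂ := fun z w => partialV f t z w • ContinuousLinearMap.id ℝ ℝ)
    (Eventually.of_forall hy) (Eventually.of_forall hv)
    ((hf.continuous_partialY t ht).smul continuous_const).continuousAt
    ((hf.continuous_partialV t ht).smul continuous_const).continuousAt).hasFDerivAt
  have h2 : HasDerivAt (fun ε : ℝ => (y + ε * p, v + ε * q)) (p, q) ε := by
    have hp := ((hasDerivAt_id ε).mul_const p).const_add y
    have hq := ((hasDerivAt_id ε).mul_const q).const_add v
    rw [one_mul] at hp hq
    exact hp.prodMk hq
  have h3 := h1.comp_hasDerivAt ε h2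
  exact h3

lemma C1ld.hasNablaDerivAt_variation {x η : ℝ → ℝ} (hx : C1ld S x)
    (hη : IsNablaAntideriv S k η) (ε : ℝ)
    (ht : t ∈ lowerKappa S) :
    HasNablaDerivAt S (fun t => x t + ε * η t) (nablaDeriv S x t + ε * k t) t :=
  (hx.hasNablaDerivAt ht).add ht.1 ((hη t ht).const_mul ht.1 ε)

namespace IsTimeInterval

variable (h : IsTimeInterval S a b) {f : ℝ → ℝ → ℝ → ℝ} {x η : ℝ → ℝ}
include h

lemma continuousOn_of_c1ld (hx : C1ld S x) : ContinuousOn x S :=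
  h.continuousOn_of_hasNablaDerivAt fun _ hk => hx.hasNablaDerivAt hk

lemma c1ld_variation (hx : C1ld S x) (hη : IsNablaAntideriv S k η) (hk : LdContinuous S k)
    (ε : ℝ) : C1ld S (fun t => x t + ε * η t) := by
  refine ⟨fun t ht => ⟨_, hx.hasNablaDerivAt_variation hη ε ht⟩, ?_⟩
  exact h.ldContinuous_congr (hx.2.add (hk.const_mul ε)) fun t ht =>
    (h.nablaDeriv_eq ht (hx.hasNablaDerivAt_variation hη ε ht)).symm

lemma along_variation (hx : C1ld S x) (hη : IsNablaAntideriv S k η) (ε : ℝ)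
    (ht : t ∈ lowerKappa S) :
    along S f (fun t => x t + ε * η t) t =
      f t (x (rho S t) + ε * η (rho S t)) (nablaDeriv S x t + ε * k t) := by
  rw [along, h.nablaDeriv_eq ht (hx.hasNablaDerivAt_variation hη ε ht)]

/-- First variation of a variational functional, in the direction of a nabla antiderivative `η` of
`k`, by differentiation under the integral sign. -/
lemma hasDerivAt_nablaIntegral_along (hf : IsLagrangian S f) (hx : C1ld S x)
    (hη : IsNablaAntideriv S k η) (hk : LdContinuous S k) :
    HasDerivAt (fun ε => nablaIntegral S (along S f (fun t => x t + ε * η t)) a b)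
      (nablaIntegral S (fun t => along S (partialY f) x t * η (rho S t) +
        along S (partialV f) x t * k t) a b) 0 := by
  have hηρ := h.ldContinuous_comp_rho (h.continuousOn_of_hasNablaDerivAt hη)
  obtain ⟨M₁, hM₁⟩ := h.exists_bound (h.ldContinuous_comp_rho (h.continuousOn_of_c1ld hx))
  obtain ⟨M₂, hM₂⟩ := h.exists_bound hx.2
  obtain ⟨N₁, hN₁⟩ := h.exists_bound hηρ
  obtain ⟨N₂, hN₂⟩ := h.exists_bound hk
  obtain ⟨N₃, hN₃⟩ := h.exists_bound (ldContinuous_of_continuousOn continuousOn_id)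
  have hN₁0 : 0 ≤ N₁ := (abs_nonneg _).trans (hN₁ a h.left_mem)
  obtain ⟨M, hM⟩ := hf.locallyBounded (max N₃ (max (M₁ + N₁) (M₂ + N₂)))
  have hM0 : 0 ≤ M := by
    refine (abs_nonneg _).trans (hM a h.left_mem ((hN₃ a h.left_mem).trans (le_max_left _ _))
      (x (rho S a)) (nablaDeriv S x a) ?_ ?_).1
    · exact (hM₁ a h.left_mem).trans ((le_add_of_nonneg_right hN₁0).trans
        ((le_max_left _ _).trans (le_max_right _ _)))
    · exact (hM₂ a h.left_mem).trans ((le_add_of_nonneg_right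
        ((abs_nonneg _).trans (hN₂ a h.left_mem))).trans
        ((le_max_right _ _).trans (le_max_right _ _)))
  have hld : LdContinuous S (fun t => along S (partialY f) x t * η (rho S t) +
      along S (partialV f) x t * k t) :=
    ((hf.ldContinuous_partialY x hx).mul hηρ).add ((hf.ldContinuous_partialV x hx).mul hk)
  have hldε := fun ε : ℝ => hf.ldContinuous _ (h.c1ld_variation hx hη hk ε)
  have key := intervalIntegral.hasDerivAt_integral_of_dominated_loc_of_deriv_le (μ := volume)
    (a := a) (b := b) (x₀ := (0 : ℝ)) (s := Ioo (-1) 1) (bound := fun _ => M * N₁ + M * N₂)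
    (F := fun ε s => along S f (fun t => x t + ε * η t) (nextPoint S s))
    (F' := fun ε s =>
      partialY f (nextPoint S s) (x (rho S (nextPoint S s)) + ε * η (rho S (nextPoint S s)))
        (nablaDeriv S x (nextPoint S s) + ε * k (nextPoint S s)) * η (rho S (nextPoint S s)) +
      partialV f (nextPoint S s) (x (rho S (nextPoint S s)) + ε * η (rho S (nextPoint S s)))
        (nablaDeriv S x (nextPoint S s) + ε * k (nextPoint S s)) * k (nextPoint S s))
    -- restricting to `|ε| < 1` keeps the arguments of the partial derivatives bounded
    (Ioo_mem_nhds (by norm_num) (by norm_num))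
    (Eventually.of_forall fun ε => h.aestronglyMeasurable_comp_nextPoint (hldε ε))
    (h.intervalIntegrable (hldε 0))
    (by simpa [along] using h.aestronglyMeasurable_comp_nextPoint hld)
    (Eventually.of_forall fun s hs ε hε => ?_) intervalIntegrable_const
    (Eventually.of_forall fun s hs ε _ => ?_)
  · have h2 := key.2
    rw [h.nablaIntegral_eq hld h.right_mem]
    have h3 : (fun ε => nablaIntegral S (along S f (fun t => x t + ε * η t)) a b) = fun ε =>
        ∫ s in a..b, along S f (fun t => x t + ε * η t) (nextPoint S s) :=
      funext fun ε => h.nablaIntegral_eq (hldε ε) h.right_mem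
    rw [h3]
    simpa [along] using h2
  · rw [uIoc_of_le h.lt.le] at hs
    have ht := h.nextPoint_mem hs.2
    set t := nextPoint S s
    have hε1 : |ε| ≤ 1 := abs_le.2 ⟨hε.1.le, hε.2.le⟩
    have hsum : ∀ {y p A B : ℝ}, |y| ≤ A → |p| ≤ B → |y + ε * p| ≤ A + B := by
      intro y p A B hy hp
      refine (abs_add_le _ _).trans (add_le_add hy ?_)
      rw [abs_mul]
      exact (mul_le_of_le_one_left (abs_nonneg p) hε1).trans hp
    obtain ⟨h1, h2⟩ := hM t ht ((hN₃ t ht).trans (le_max_left _ _)) _ _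
      ((hsum (hM₁ t ht) (hN₁ t ht)).trans ((le_max_left _ _).trans (le_max_right _ _)))
      ((hsum (hM₂ t ht) (hN₂ t ht)).trans ((le_max_right _ _).trans (le_max_right _ _)))
    rw [Real.norm_eq_abs]
    refine (abs_add_le _ _).trans (add_le_add ?_ ?_)
    · rw [abs_mul]
      exact mul_le_mul h1 (hN₁ t ht) (abs_nonneg _) hM0
    · rw [abs_mul]
      exact mul_le_mul h2 (hN₂ t ht) (abs_nonneg _) hM0
  · rw [uIoc_of_le h.lt.le] at hs
    have ht := h.nextPoint_mem_lowerKappa hs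
    simp only [h.along_variation hx hη _ ht]
    exact hf.hasDerivAt_line ht.1 _ _ _ _ ε

lemma eventually_norm1_lt (hη : IsNablaAntideriv S k η) (hk : LdContinuous S k) {δ : ℝ}
    (hδ : 0 < δ) : ∀ᶠ ε : ℝ in 𝓝 0, norm1 S (fun t => ε * η t) < δ := by
  obtain ⟨N₁, hN₁⟩ :=
    h.exists_bound (h.ldContinuous_comp_rho (h.continuousOn_of_hasNablaDerivAt hη))
  obtain ⟨N₂, hN₂⟩ := h.exists_bound hk
  have hN₁0 : 0 ≤ N₁ := (abs_nonneg _).trans (hN₁ a h.left_mem)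
  have hN₂0 : 0 ≤ N₂ := (abs_nonneg _).trans (hN₂ a h.left_mem)
  have hlim : Tendsto (fun ε : ℝ => |ε| * N₁ + |ε| * N₂) (𝓝 0) (𝓝 0) := by
    have : Continuous fun ε : ℝ => |ε| * N₁ + |ε| * N₂ := by fun_prop
    simpa using this.tendsto 0
  filter_upwards [hlim.eventually (gt_mem_nhds hδ)] with ε hε
  refine lt_of_le_of_lt (add_le_add ?_ ?_) hε
  · refine Real.sSup_le ?_ (by positivity)
    rintro _ ⟨t, ht, rfl⟩
    simp only [abs_mul]
    gcongr
    exact hN₁ t ht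
  · refine Real.sSup_le ?_ (by positivity)
    rintro _ ⟨t, ht, rfl⟩
    simp only [h.nablaDeriv_eq ht ((hη t ht).const_mul ht.1 ε), abs_mul]
    gcongr
    exact hN₂ t ht.1

/-! ### The du Bois-Reymond lemma -/

lemma nablaIntegral_const (c : ℝ) : nablaIntegral S (fun _ => c) a b = c * (b - a) := by
  rw [h.nablaIntegral_eq (ldContinuous_of_continuousOn continuousOn_const) h.right_mem,
    intervalIntegral.integral_const, smul_eq_mul, mul_comm]

/-- Integration by parts: if `A` denotes the indefinite integral of `P` and `η^∇ = k`, then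
`∫ P η^ρ ∇t = A(b) η(b) - ∫ A k ∇t`. -/
lemma nablaIntegral_mul_comp_rho {P : ℝ → ℝ} (hP : LdContinuous S P)
    (hη : IsNablaAntideriv S k η) (hk : LdContinuous S k) :
    nablaIntegral S (fun t => P t * η (rho S t)) a b +
      nablaIntegral S (fun t => nablaIntegral S P a t * k t) a b =
        nablaIntegral S P a b * η b := by
  have hA := h.isNablaAntideriv_nablaIntegral hP
  have hη' := h.ldContinuous_comp_rho (h.continuousOn_of_hasNablaDerivAt hη)
  have hA' := ldContinuous_of_continuousOn (h.continuousOn_of_hasNablaDerivAt hA)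
  rw [← h.nablaIntegral_add (hP.mul hη') (hA'.mul hk) h.right_mem,
    h.nablaIntegral_eq_sub ((hP.mul hη').add (hA'.mul hk))
      (G := fun t => nablaIntegral S P a t * η t) (fun t ht => (hA t ht).mul ht.1 (hη t ht))
      h.right_mem, h.nablaIntegral_self hP]
  ring

/-- The du Bois-Reymond lemma with optional end-point conditions: `p` and `q` say that the variation
`η` is free at `a` and at `b`, respectively. -/
theorem exists_eq_add_const {P Q : ℝ → ℝ} (hP : LdContinuous S P) (hQ : LdContinuous S Q)
    {p q : Prop} (H : ∀ η k : ℝ → ℝ, IsNablaAntideriv S k η → LdContinuous S k →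
      (p ∨ η a = 0) → (q ∨ η b = 0) →
      nablaIntegral S (fun t => P t * η (rho S t) + Q t * k t) a b = 0) :
    ∃ c : ℝ, (∀ t ∈ lowerKappa S, Q t = nablaIntegral S P a t + c) ∧ (p → c = 0) ∧
      (q → nablaIntegral S P a b + c = 0) := by
  set A : ℝ → ℝ := fun t => nablaIntegral S P a t with hAdef
  have hA : LdContinuous S A := ldContinuous_of_continuousOn
    (h.continuousOn_of_hasNablaDerivAt (h.isNablaAntideriv_nablaIntegral hP))
  set R : ℝ → ℝ := fun t => Q t + -1 * A t with hRdef
  have hR : LdContinuous S R := hQ.add (hA.const_mul (-1))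
  have hcst : ∀ c : ℝ, LdContinuous S (fun _ => c) := fun c =>
    ldContinuous_of_continuousOn continuousOn_const
  have hparts : ∀ η k : ℝ → ℝ, IsNablaAntideriv S k η → LdContinuous S k →
      (p ∨ η a = 0) → (q ∨ η b = 0) → nablaIntegral S (fun t => R t * k t) a b = -(A b * η b) := by
    intro η k hη hk hpa hqb
    have hη' := h.ldContinuous_comp_rho (h.continuousOn_of_hasNablaDerivAt hη)
    have h1 := H η k hη hk hpa hqb
    rw [h.nablaIntegral_add (hP.mul hη') (hQ.mul hk) h.right_mem] at h1
    have h2 := h.nablaIntegral_mul_comp_rho hP hη hk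
    have h3 : (fun t => R t * k t) = fun t => Q t * k t + -1 * (A t * k t) := by
      funext t
      simp only [hRdef]
      ring
    rw [h3, h.nablaIntegral_add (hQ.mul hk) ((hA.mul hk).const_mul _) h.right_mem,
      h.nablaIntegral_const_mul _ (hA.mul hk) h.right_mem]
    simp only [hAdef]
    linarith
  have hba : b - a ≠ 0 := (sub_pos.2 h.lt).ne'
  -- the mean of `R`; then the indefinite integral of `R - c` vanishes at both end points
  set c : ℝ := nablaIntegral S R a b / (b - a) with hc
  set k : ℝ → ℝ := fun t => R t + -c with hkdef
  have hk : LdContinuous S k := hR.add (hcst _)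
  have hk0 : nablaIntegral S k a b = 0 := by
    rw [hkdef, h.nablaIntegral_add hR (hcst _) h.right_mem, h.nablaIntegral_const, hc]
    field_simp
    ring
  have hsq : nablaIntegral S (fun t => k t * k t) a b = 0 := by
    have h1 := hparts _ k (h.isNablaAntideriv_nablaIntegral hk) hk
      (Or.inr (h.nablaIntegral_self hk)) (Or.inr hk0)
    have h2 : (fun t => k t * k t) = fun t => R t * k t + -c * k t := by
      funext t
      simp only [hkdef]
      ring
    rw [h2, h.nablaIntegral_add (hR.mul hk) (hk.const_mul _) h.right_mem,
      h.nablaIntegral_const_mul _ hk h.right_mem, h1, hk0]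
    ring
  have hRc : ∀ t ∈ lowerKappa S, R t = c := fun t ht => by
    have := h.eq_zero_of_nablaIntegral_sq hk hsq ht
    simp only [hkdef] at this
    linarith
  -- affine variations settle the free end points
  have hlin : ∀ m n : ℝ, IsNablaAntideriv S (fun _ => m) (fun t => m * t + n) := by
    intro m n t ht
    refine hasNablaDerivAt_of_hasDerivAt ht.1 (by fun_prop) ?_ (by ring)
    simpa using ((hasDerivAt_id t).const_mul m).add_const n
  have hRm : ∀ m : ℝ, nablaIntegral S (fun t => R t * m) a b = c * m * (b - a) := by
    intro m
    rw [h.nablaIntegral_congr (hR.mul (hcst m)) (hcst (c * m)) fun t ht => by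
      simp only [hRc t ht], h.nablaIntegral_const]
  refine ⟨c, fun t ht => ?_, fun hp => ?_, fun hq => ?_⟩
  · have := hRc t ht
    simp only [hRdef, hAdef] at this
    linarith
  · have h1 := hparts _ _ (hlin (-1) b) (hcst _) (Or.inl hp) (Or.inr (by ring))
    rw [hRm] at h1
    refine mul_right_cancel₀ hba ?_
    linarith
  · have h1 := hparts _ _ (hlin 1 (-a)) (hcst _) (Or.inr (by ring)) (Or.inl hq)
    rw [hRm] at h1
    refine mul_right_cancel₀ hba ?_
    simp only [hAdef] at h1
    linarith

end IsTimeInterval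

/-! ### Stationarity of the product functional -/

lemma isTimeInterval_interval {T : Set ℝ} (hT : IsClosed T) (ha : a ∈ T) (hb : b ∈ T)
    (hab : a < b) : IsTimeInterval (interval T a b) a b where
  isClosed := hT.inter isClosed_Icc
  isLeast := ⟨⟨ha, left_mem_Icc.2 hab.le⟩, fun _ hs => hs.2.1⟩
  isGreatest := ⟨⟨hb, right_mem_Icc.2 hab.le⟩, fun _ hs => hs.2.2⟩
  lt := hab

lemma nablaIntegral_same (S : Set ℝ) (g : ℝ → ℝ) (c : ℝ) : nablaIntegral S g c c = 0 := by
  unfold nablaIntegral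
  split_ifs
  · exact sub_self _
  · rfl

lemma admissible_variation {T : Set ℝ} (h : IsTimeInterval (interval T a b) a b)
    {xa xb : Option ℝ} {x η : ℝ → ℝ} (hx : Admissible T a b xa xb x)
    (hη : IsNablaAntideriv (interval T a b) k η) (hk : LdContinuous (interval T a b) k)
    (hpa : xa = none ∨ η a = 0) (hqb : xb = none ∨ η b = 0) (ε : ℝ) :
    Admissible T a b xa xb (fun t => x t + ε * η t) := by
  refine ⟨h.c1ld_variation hx.1 hη hk ε, fun c hc => ?_, fun c hc => ?_⟩
  · rcases hpa with hpa | hpa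
    · simp [hpa] at hc
    · simp [hpa, hx.2.1 c hc]
  · rcases hqb with hqb | hqb
    · simp [hqb] at hc
    · simp [hqb, hx.2.2 c hc]

/-- The first variation of a product of two variational functionals vanishes at a weak local
extremizer. -/
theorem nablaIntegral_variation_eq_zero {T : Set ℝ} (h : IsTimeInterval (interval T a b) a b)
    {f₁ f₂ : ℝ → ℝ → ℝ → ℝ} (hf₁ : IsLagrangian (interval T a b) f₁)
    (hf₂ : IsLagrangian (interval T a b) f₂) {xa xb : Option ℝ} {x η : ℝ → ℝ}
    (hx : IsWeakLocalMin T a b xa xb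
        (fun x => functional T a b f₁ x * functional T a b f₂ x) x ∨
      IsWeakLocalMax T a b xa xb
        (fun x => functional T a b f₁ x * functional T a b f₂ x) x)
    (hη : IsNablaAntideriv (interval T a b) k η) (hk : LdContinuous (interval T a b) k)
    (hpa : xa = none ∨ η a = 0) (hqb : xb = none ∨ η b = 0) :
    functional T a b f₂ x * nablaIntegral (interval T a b) (fun t =>
        along (interval T a b) (partialY f₁) x t * η (rho (interval T a b) t) +
          along (interval T a b) (partialV f₁) x t * k t) a b +
      functional T a b f₁ x * nablaIntegral (interval T a b) (fun t =>
        along (interval T a b) (partialY f₂) x t * η (rho (interval T a b) t) +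
          along (interval T a b) (partialV f₂) x t * k t) a b = 0 := by
  have hadm : Admissible T a b xa xb x := hx.elim (fun h => h.1) (fun h => h.1)
  have hx0 : (fun t => x t + 0 * η t) = x := by simp
  have hdiff : ∀ ε : ℝ, (fun t => x t + ε * η t - x t) = fun t => ε * η t := fun ε => by
    simp
  have hd := (h.hasDerivAt_nablaIntegral_along hf₁ hadm.1 hη hk).mul
    (h.hasDerivAt_nablaIntegral_along hf₂ hadm.1 hη hk)
  rw [hx0] at hd
  have hzero : nablaIntegral (interval T a b) (fun t =>
        along (interval T a b) (partialY f₁) x t * η (rho (interval T a b) t) +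
          along (interval T a b) (partialV f₁) x t * k t) a b * functional T a b f₂ x +
      functional T a b f₁ x * nablaIntegral (interval T a b) (fun t =>
        along (interval T a b) (partialY f₂) x t * η (rho (interval T a b) t) +
          along (interval T a b) (partialV f₂) x t * k t) a b = 0 := by
    rcases hx with ⟨-, δ, hδ, hmin⟩ | ⟨-, δ, hδ, hmax⟩
    · refine IsLocalMin.hasDerivAt_eq_zero ?_ hd
      filter_upwards [h.eventually_norm1_lt hη hk hδ] with ε hε
      have := hmin _ (admissible_variation h hadm hη hk hpa hqb ε) (by rwa [hdiff])
      simpa [functional] using this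
    · refine IsLocalMax.hasDerivAt_eq_zero ?_ hd
      filter_upwards [h.eventually_norm1_lt hη hk hδ] with ε hε
      have := hmax _ (admissible_variation h hadm hη hk hpa hqb ε) (by rwa [hdiff])
      simpa [functional] using this
  linarith

end TimeScale

theorem mainTheorem2 (T : Set ℝ) (hT : IsClosed T) (a b : ℝ) (ha : a ∈ T) (hb : b ∈ T)
    (hab : a ≤ b) (I : Set ℝ) (hI : I = interval T a b) (f₁ f₂ : ℝ → ℝ → ℝ → ℝ)
    (hf₁ : IsLagrangian I f₁) (hf₂ : IsLagrangian I f₂)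
    (xa xb : Option ℝ) (x₀ : ℝ → ℝ)
    (hx₀ : IsWeakLocalMin T a b xa xb
        (fun x => functional T a b f₁ x * functional T a b f₂ x) x₀ ∨
      IsWeakLocalMax T a b xa xb
        (fun x => functional T a b f₁ x * functional T a b f₂ x) x₀)
    (F₁ F₂ : ℝ) (hF₁ : F₁ = functional T a b f₁ x₀) (hF₂ : F₂ = functional T a b f₂ x₀)
    (f₁y f₁v f₂y f₂v : ℝ → ℝ)
    (hf₁y : f₁y = along I (partialY f₁) x₀) (hf₁v : f₁v = along I (partialV f₁) x₀)
    (hf₂y : f₂y = along I (partialY f₂) x₀) (hf₂v : f₂v = along I (partialV f₂) x₀) :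
    -- Euler–Lagrange equation
    (∀ t ∈ lowerKappa I, rho I t ∈ lowerKappa I →
      HasNablaDerivAt I (fun s => F₂ * f₁v s + F₁ * f₂v s) (F₂ * f₁y t + F₁ * f₂y t) t ∧
      ∀ d₁ d₂ : ℝ, HasNablaDerivAt I f₁v d₁ t → HasNablaDerivAt I f₂v d₂ t →
        F₂ * (d₁ - f₁y t) + F₁ * (d₂ - f₂y t) = 0) ∧
    -- If `a` is right-scattered, then `x₀^∇(a)` is undefined; the equation then holds on all of
    -- `[a, b]_κ` for a suitable value at `a` of the differentiated function.
    (a ∉ lowerKappa I → ∃ c : ℝ, ∀ t ∈ lowerKappa I,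
      HasNablaDerivAt I (Function.update (fun s => F₂ * f₁v s + F₁ * f₂v s) a c)
        (F₂ * f₁y t + F₁ * f₂y t) t) ∧
    -- natural boundary condition at `a`
    (xa = none →
      F₂ * (nablaIntegral I f₁y a (sigma I a) - f₁v (sigma I a)) +
        F₁ * (nablaIntegral I f₂y a (sigma I a) - f₂v (sigma I a)) = 0) ∧
    -- natural boundary condition at `b`
    (xb = none → F₂ * f₁v b + F₁ * f₂v b = 0) := by
  rcases hab.eq_or_lt with rfl | hlt
  · -- on a single point every integral vanishes, and `F₁ = F₂ = 0`
    have h1 : F₁ = 0 := hF₁.trans (nablaIntegral_same _ _ _)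
    have h2 : F₂ = 0 := hF₂.trans (nablaIntegral_same _ _ _)
    have h0 : ∀ t, HasNablaDerivAt I (fun _ => 0) 0 t := fun t ε hε =>
      ⟨Set.univ, univ_mem, fun s _ => by simpa using mul_nonneg hε.le (abs_nonneg _)⟩
    have hu : Function.update (fun _ : ℝ => (0 : ℝ)) a 0 = fun _ => 0 :=
      Function.update_eq_self a _
    simp only [h1, h2, zero_mul, add_zero, implies_true, and_true]
    exact ⟨fun t _ _ => h0 t, fun _ => ⟨0, fun t _ => by rw [hu]; exact h0 t⟩⟩
  have h : IsTimeInterval I a b := hI ▸ isTimeInterval_interval hT ha hb hlt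
  have hx : C1ld I x₀ := hI ▸ hx₀.elim (fun h => h.1.1) (fun h => h.1.1)
  have l₁y : LdContinuous I f₁y := hf₁y ▸ hf₁.ldContinuous_partialY x₀ hx
  have l₁v : LdContinuous I f₁v := hf₁v ▸ hf₁.ldContinuous_partialV x₀ hx
  have l₂y : LdContinuous I f₂y := hf₂y ▸ hf₂.ldContinuous_partialY x₀ hx
  have l₂v : LdContinuous I f₂v := hf₂v ▸ hf₂.ldContinuous_partialV x₀ hx
  have lP := (l₁y.const_mul F₂).add (l₂y.const_mul F₁)
  have lQ := (l₁v.const_mul F₂).add (l₂v.const_mul F₁)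
  obtain ⟨c, hc, hca, hcb⟩ := h.exists_eq_add_const lP lQ (p := xa = none) (q := xb = none) (by
    intro η k hη hk hpa hqb
    have hηρ := h.ldContinuous_comp_rho (h.continuousOn_of_hasNablaDerivAt hη)
    have l₁ := (l₁y.mul hηρ).add (l₁v.mul hk)
    have l₂ := (l₂y.mul hηρ).add (l₂v.mul hk)
    have hsplit : (fun t => (F₂ * f₁y t + F₁ * f₂y t) * η (rho I t) +
        (F₂ * f₁v t + F₁ * f₂v t) * k t) = fun t =>
          F₂ * (f₁y t * η (rho I t) + f₁v t * k t) +
            F₁ * (f₂y t * η (rho I t) + f₂v t * k t) := by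
      funext t
      ring
    rw [hsplit, h.nablaIntegral_add (l₁.const_mul _) (l₂.const_mul _) h.right_mem,
      h.nablaIntegral_const_mul _ l₁ h.right_mem, h.nablaIntegral_const_mul _ l₂ h.right_mem]
    subst hI hF₁ hF₂ hf₁y hf₁v hf₂y hf₂v
    exact nablaIntegral_variation_eq_zero h hf₁ hf₂ hx₀ hη hk hpa hqb)
  set A : ℝ → ℝ := fun t => nablaIntegral I (fun s => F₂ * f₁y s + F₁ * f₂y s) a t with hA
  have hAc : ∀ t ∈ lowerKappa I,
      HasNablaDerivAt I (fun s => A s + c) (F₂ * f₁y t + F₁ * f₂y t) t := by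
    intro t ht
    have h1 : HasNablaDerivAt I (fun _ => c) 0 t :=
      hasNablaDerivAt_of_hasDerivAt ht.1 continuous_const (hasDerivAt_const t c) (by ring)
    simpa using (h.isNablaAntideriv_nablaIntegral lP t ht).add ht.1 h1
  have hAsplit : ∀ t ∈ I, A t = F₂ * nablaIntegral I f₁y a t + F₁ * nablaIntegral I f₂y a t := by
    intro t ht
    rw [hA]
    simp only
    rw [h.nablaIntegral_add (l₁y.const_mul _) (l₂y.const_mul _) ht,
      h.nablaIntegral_const_mul _ l₁y ht, h.nablaIntegral_const_mul _ l₂y ht]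
  refine ⟨fun t ht hρ => ?_, fun hak => ⟨c, fun t ht => ?_⟩, fun hxa => ?_, fun hxb => ?_⟩
  · have hEL : HasNablaDerivAt I (fun s => F₂ * f₁v s + F₁ * f₂v s)
        (F₂ * f₁y t + F₁ * f₂y t) t := by
      refine (hAc t ht).congr (hc _ hρ).symm ?_
      by_cases hak : a ∈ lowerKappa I
      · filter_upwards [self_mem_nhdsWithin] with s hs
        refine (hc s ?_).symm
        by_contra hs'
        exact hs' (h.eq_left_of_notMem_lowerKappa hs hs' ▸ hak)
      · -- the value at `a` is irrelevant here: `a` is neither near `t` nor equal to `ρ(t)`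
        have hta : t ≠ a := fun hta => hak (hta ▸ ht)
        filter_upwards [self_mem_nhdsWithin,
          mem_nhdsWithin_of_mem_nhds (isOpen_ne.mem_nhds hta)] with s hs hsa
        exact (hc s (h.mem_lowerKappa hs hsa)).symm
    -- the nabla derivative is unique on `I_κ`
    refine ⟨hEL, fun d₁ d₂ hd₁ hd₂ => ?_⟩
    have h1 := h.hasNablaDerivAt_unique ht hEL
      ((hd₁.const_mul ht.1 F₂).add ht.1 (hd₂.const_mul ht.1 F₁))
    linarith
  · -- as `A a = 0`, the suitable value at `a` is `c`
    have hAeq : ∀ s ∈ I, A s + c =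
        Function.update (fun s => F₂ * f₁v s + F₁ * f₂v s) a c s := by
      intro s hs
      by_cases hsa : s = a
      · subst hsa
        rw [Function.update_self, hA]
        simp only
        rw [nablaIntegral_same, zero_add]
      · rw [Function.update_of_ne hsa]
        exact (hc s (h.mem_lowerKappa hs hsa)).symm
    refine (hAc t ht).congr (hAeq _ (h.rho_mem ht.1)) ?_
    filter_upwards [self_mem_nhdsWithin] with s hs using hAeq s hs
  · have h1 := hc _ h.sigma_left_mem_lowerKappa
    have h2 := hAsplit _ h.sigma_left_mem
    simp only [hA] at h2
    rw [hca hxa] at h1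
    linarith
  · exact (hc b h.right_mem_lowerKappa).trans (hcb hxb)
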